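/- Let $M$ be a nonempty smooth manifold of dimension $n\ge 3$ and let $\mathcal X$ be a simply transitive Lie algebra of vector fields on $M$, that is, a real vector space of $C^\infty$ vector fields on $M$, closed under the Lie bracket, such that the evaluation map $\mathcal X\ni w\mapsto w(x)\in T_xM$ is bijective for every $x\in M$ (for instance, the left-invariant vector fields on a Lie group). Let $V\subset\mathcal X$ be a codimension-one subspace, $u\in\mathcal X\smallsetminus V$, let $\langle\,,\rangle$ be a nondegenerate symmetric bilinear form on $V$, let $F:V\to V$ be a linear operator that is self-adjoint relative to $\langle\,,\rangle$, and let $\delta\in\{1,-1\}$. Suppose that $[u,v]=Fv$ and $[v,v']=0$ for all $v,v'\in V$, and let $g$ be the pseudo-Riemannian metric on $M$ with $g(u,u)=\delta$, $g(u,v)=0$ and $g(v,v')=\langle v,v'\rangle$ for all $v,v'\in V$. Suppose that $g$ is Einstein, i.e. $\mathrm{Ric}=\frac{\mathrm s}{n}\,g$, where $\mathrm{s}$ is the scalar curvature. Then at least one of the following conditions holds: (i) $F=\lambda\cdot\mathrm{Id}$ for some $\lambda\in\mathbb R$; (ii) $F\ne 0$, $\operatorname{tr}F=0$ and $F^2=0$;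 (iii) $F^2\ne 0$ and $\operatorname{tr}F=\operatorname{tr}F^2=0$. In case (i), $g$ has constant sectional curvature $-\delta\lambda^2$. In case (ii), if in addition $n=4$, the metric $g$ is flat. In case (iii), $g$ is Ricci-flat but not locally symmetric (its curvature tensor is not parallel). -/

import Mathlib

open scoped Manifold ContDiff

noncomputable section

namespace Petrov

/-! Throughout, `M` is a smooth manifold without boundary modelled on a finite-dimensional real
normed space `E`; a vector field is a function `X : Π x : M, TangentSpace 𝓘(ℝ, E) x`. -/

section General

variable {E : Type*} [NormedAddCommGroup E] [NormedSpace ℝ E]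
  {M : Type*} [TopologicalSpace M] [ChartedSpace E M]

/-- A `C^∞` vector field on `M`. -/
def IsSmoothVectorField [IsManifold 𝓘(ℝ, E) ∞ M] (X : Π x : M, TangentSpace 𝓘(ℝ, E) x) : Prop :=
  ContMDiff 𝓘(ℝ, E) 𝓘(ℝ, E).tangent ∞ (fun x ↦ (⟨x, X x⟩ : TangentBundle 𝓘(ℝ, E) M))

/-- A simply transitive Lie algebra of vector fields on `M`: a real vector space of `C^∞` vector
fields, closed under the Lie bracket, such that the evaluation `w ↦ w x` is a bijection onto the
tangent space at every point `x`. -/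
structure IsSimplyTransitive [IsManifold 𝓘(ℝ, E) ∞ M]
    (𝒳 : Submodule ℝ (Π x : M, TangentSpace 𝓘(ℝ, E) x)) : Prop where
  smooth : ∀ X ∈ 𝒳, IsSmoothVectorField X
  lie_mem : ∀ X ∈ 𝒳, ∀ Y ∈ 𝒳, VectorField.mlieBracket 𝓘(ℝ, E) X Y ∈ 𝒳
  bijective_eval : ∀ x : M,
    Function.Bijective (fun w : 𝒳 ↦ (w : Π x : M, TangentSpace 𝓘(ℝ, E) x) x)

variable (E M) in
/-- A `C^∞` pseudo-Riemannian metric on `M` (of arbitrary signature). -/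
structure PseudoRiemannianMetric [IsManifold 𝓘(ℝ, E) ∞ M] where
  /-- The symmetric bilinear form on each tangent space. -/
  inner (x : M) : TangentSpace 𝓘(ℝ, E) x →L[ℝ] TangentSpace 𝓘(ℝ, E) x →L[ℝ] ℝ
  symm (x : M) (v w : TangentSpace 𝓘(ℝ, E) x) : inner x v w = inner x w v
  nondegenerate (x : M) (v : TangentSpace 𝓘(ℝ, E) x) (hv : ∀ w, inner x v w = 0) : v = 0
  contMDiff : ContMDiff 𝓘(ℝ, E) (𝓘(ℝ, E).prod 𝓘(ℝ, E →L[ℝ] E →L[ℝ] ℝ)) ∞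
    (fun x ↦ Bundle.TotalSpace.mk' (E →L[ℝ] E →L[ℝ] ℝ)
      (E := fun x : M ↦ TangentSpace 𝓘(ℝ, E) x →L[ℝ] TangentSpace 𝓘(ℝ, E) x →L[ℝ] ℝ)
      x (inner x))

variable (E M) in
/-- A connection in the tangent bundle of `M`; `∇ Y x (X x)` is the value at `x` of the covariant
derivative of `Y` in the direction of `X`. -/
abbrev Connection [IsManifold 𝓘(ℝ, E) ∞ M] :=
  CovariantDerivative 𝓘(ℝ, E) E (TangentSpace 𝓘(ℝ, E) : M → Type _)

variable [IsManifold 𝓘(ℝ, E) ∞ M] [FiniteDimensional ℝ E]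

instance (x : M) : FiniteDimensional ℝ (TangentSpace 𝓘(ℝ, E) x) :=
  inferInstanceAs (FiniteDimensional ℝ E)

/-- `∇` is the Levi-Civita connection of `g`: it is torsion-free and `∇ g = 0`. -/
structure IsLeviCivita (g : PseudoRiemannianMetric E M) (nabla : Connection E M) : Prop where
  torsion_eq_zero : nabla.torsion = 0
  metric : ∀ (x : M) (Y Z : Π x : M, TangentSpace 𝓘(ℝ, E) x),
    MDifferentiableAt 𝓘(ℝ, E) 𝓘(ℝ, E).tangent
      (fun y ↦ (⟨y, Y y⟩ : TangentBundle 𝓘(ℝ, E) M)) x →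
    MDifferentiableAt 𝓘(ℝ, E) 𝓘(ℝ, E).tangent
      (fun y ↦ (⟨y, Z y⟩ : TangentBundle 𝓘(ℝ, E) M)) x →
    ∀ a : TangentSpace 𝓘(ℝ, E) x,
      mvfderiv 𝓘(ℝ, E) (fun y ↦ g.inner y (Y y) (Z y)) x a =
        g.inner x (nabla Y x a) (Z x) + g.inner x (Y x) (nabla Z x a)

/-- The curvature expression `R(X, Y)Z = ∇_Y ∇_X Z - ∇_X ∇_Y Z + ∇_[X,Y] Z` for vector fields
`X, Y, Z`. -/
def curvatureField (nabla : Connection E M) (X Y Z : Π x : M, TangentSpace 𝓘(ℝ, E) x) :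
    Π x : M, TangentSpace 𝓘(ℝ, E) x :=
  fun x ↦ nabla (fun y ↦ nabla Z y (X y)) x (Y x) - nabla (fun y ↦ nabla Z y (Y y)) x (X x)
    + nabla Z x (VectorField.mlieBracket 𝓘(ℝ, E) X Y x)

/-- The curvature tensor `R` at the point `x`, so that `curvature ∇ x a b c` is `R(a, b)c`.
It is the trilinear map whose values on the vectors of a basis of the tangent space are the values
at `x` of `R(X, Y)Z`, where `X, Y, Z` extend these vectors to vector fields that are `C^∞` near `x`.
(For a Levi-Civita connection `R(X, Y)Z` is tensorial, so that neither the basis nor the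
extensions matter.) -/
def curvature (nabla : Connection E M) (x : M) :
    TangentSpace 𝓘(ℝ, E) x →ₗ[ℝ] TangentSpace 𝓘(ℝ, E) x →ₗ[ℝ] TangentSpace 𝓘(ℝ, E) x →ₗ[ℝ]
      TangentSpace 𝓘(ℝ, E) x :=
  let e := Module.finBasis ℝ (TangentSpace 𝓘(ℝ, E) x)
  e.constr ℝ fun i ↦ e.constr ℝ fun j ↦ e.constr ℝ fun k ↦
    curvatureField nabla (FiberBundle.extend E (e i)) (FiberBundle.extend E (e j))
      (FiberBundle.extend E (e k)) x

/-- The Ricci tensor, `Ric(a, c) = Trace [v ↦ R(a, v)c]`. -/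
def ricci (nabla : Connection E M) (x : M) : LinearMap.BilinForm ℝ (TangentSpace 𝓘(ℝ, E) x) :=
  LinearMap.mk₂ ℝ (fun a c ↦ LinearMap.trace ℝ _ ((curvature nabla x a).flip c))
    (fun a a' c ↦ by
      rw [← map_add]
      congr 1
      ext v
      simp)
    (fun r a c ↦ by
      rw [← map_smul]
      congr 1
      ext v
      simp)
    (fun a c c' ↦ by rw [map_add, map_add])
    (fun r a c ↦ by rw [map_smul, map_smul])

namespace PseudoRiemannianMetric

variable (g : PseudoRiemannianMetric E M)

/-- The isomorphism `v ↦ g(v, ·)` of the tangent space onto its dual. -/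
def flat (x : M) :
    TangentSpace 𝓘(ℝ, E) x ≃ₗ[ℝ] Module.Dual ℝ (TangentSpace 𝓘(ℝ, E) x) :=
  LinearEquiv.ofInjectiveOfFinrankEq
    (LinearMap.mk₂ ℝ (fun v w ↦ g.inner x v w) (by simp) (by simp) (by simp) (by simp))
    ((injective_iff_map_eq_zero _).2 fun v hv ↦
      g.nondegenerate x v fun w ↦ by simpa using LinearMap.congr_fun hv w)
    (Subspace.dual_finrank_eq).symm

/-- The scalar curvature `s = Trace_g Ric`. -/
def scalarCurvature (nabla : Connection E M) (x : M) : ℝ :=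
  LinearMap.trace ℝ _ ((g.flat x).symm.toLinearMap ∘ₗ ricci nabla x)

/-- `g` is an Einstein metric: `dim M ≥ 3` and `Ric = (s / n) g` with `n = dim M`. -/
def IsEinstein (nabla : Connection E M) : Prop :=
  3 ≤ Module.finrank ℝ E ∧ ∀ (x : M) (a b : TangentSpace 𝓘(ℝ, E) x),
    ricci nabla x a b = g.scalarCurvature nabla x / (Module.finrank ℝ E : ℝ) * g.inner x a b

/-- The sectional curvature of every nondegenerate tangent plane, spanned by `a` and `b`, is `κ`. -/
def HasConstantSectionalCurvature (nabla : Connection E M) (κ : ℝ) : Prop :=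
  ∀ (x : M) (a b : TangentSpace 𝓘(ℝ, E) x),
    g.inner x a a * g.inner x b b - g.inner x a b ^ 2 ≠ 0 →
      g.inner x (curvature nabla x a b a) b /
        (g.inner x a a * g.inner x b b - g.inner x a b ^ 2) = κ

end PseudoRiemannianMetric

/-- The curvature tensor vanishes. -/
def IsFlat (nabla : Connection E M) : Prop := ∀ x : M, curvature nabla x = 0

/-- The Ricci tensor vanishes. -/
def IsRicciFlat (nabla : Connection E M) : Prop := ∀ x : M, ricci nabla x = 0

/-- `(∇_W R)(X, Y)Z = ∇_W(R(X, Y)Z) - R(∇_W X, Y)Z - R(X, ∇_W Y)Z - R(X, Y)∇_W Z`. -/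
def curvatureDerivative (nabla : Connection E M) (W X Y Z : Π x : M, TangentSpace 𝓘(ℝ, E) x) :
    Π x : M, TangentSpace 𝓘(ℝ, E) x :=
  fun x ↦ nabla (fun y ↦ curvature nabla y (X y) (Y y) (Z y)) x (W x)
    - curvature nabla x (nabla X x (W x)) (Y x) (Z x)
    - curvature nabla x (X x) (nabla Y x (W x)) (Z x)
    - curvature nabla x (X x) (Y x) (nabla Z x (W x))

/-- Local symmetry: the curvature tensor is parallel. -/
def IsLocallySymmetric (nabla : Connection E M) : Prop :=
  ∀ W X Y Z : Π x : M, TangentSpace 𝓘(ℝ, E) x,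
    IsSmoothVectorField W → IsSmoothVectorField X → IsSmoothVectorField Y →
    IsSmoothVectorField Z → curvatureDerivative nabla W X Y Z = 0

end General

section Construction

variable {E : Type*} [NormedAddCommGroup E] [NormedSpace ℝ E]
  {M : Type*} [TopologicalSpace M] [ChartedSpace E M] [IsManifold 𝓘(ℝ, E) ∞ M]

/-- The algebraic data on a simply transitive Lie algebra `𝒳` of vector fields: a codimension-one
subspace `V`, an element `u` outside `V`, a nondegenerate symmetric bilinear form `⟨ , ⟩` on `V`,
an operator `F` on `V` self-adjoint relative to `⟨ , ⟩`, and a sign `δ`, such that the Lie bracket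
satisfies `[u, v] = F v` and `[v, v'] = 0` for `v, v' ∈ V`. -/
structure IsPetrovData (𝒳 : Submodule ℝ (Π x : M, TangentSpace 𝓘(ℝ, E) x)) (V : Submodule ℝ 𝒳)
    (u : 𝒳) (form : LinearMap.BilinForm ℝ V) (F : V →ₗ[ℝ] V) (δ : ℝ) : Prop where
  simplyTransitive : IsSimplyTransitive 𝒳
  codim_one : Module.finrank ℝ V + 1 = Module.finrank ℝ 𝒳
  u_notMem : u ∉ V
  symm : ∀ v w : V, form v w = form w v
  nondegenerate : ∀ v : V, (∀ w : V, form v w = 0) → v = 0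
  selfAdjoint : ∀ v w : V, form (F v) w = form v (F w)
  sign : δ = 1 ∨ δ = -1
  bracket_u : ∀ v : V,
    VectorField.mlieBracket 𝓘(ℝ, E) (u : Π x : M, TangentSpace 𝓘(ℝ, E) x) (v : 𝒳) = (F v : 𝒳)
  bracket_V : ∀ v w : V,
    VectorField.mlieBracket 𝓘(ℝ, E) ((v : 𝒳) : Π x : M, TangentSpace 𝓘(ℝ, E) x) (w : 𝒳) = 0

/-- `g` is the pseudo-Riemannian metric on `M` determined by `g(u, u) = δ`, `g(u, v) = 0` and
`g(v, v') = ⟨v, v'⟩` for `v, v' ∈ V`. -/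
structure IsPetrovMetric (g : PseudoRiemannianMetric E M)
    {𝒳 : Submodule ℝ (Π x : M, TangentSpace 𝓘(ℝ, E) x)} {V : Submodule ℝ 𝒳}
    (u : 𝒳) (form : LinearMap.BilinForm ℝ V) (δ : ℝ) : Prop where
  inner_u_u : ∀ x : M, g.inner x (u.1 x) (u.1 x) = δ
  inner_u_V : ∀ (x : M) (v : V), g.inner x (u.1 x) (v.1.1 x) = 0
  inner_V_V : ∀ (x : M) (v w : V), g.inner x (v.1.1 x) (w.1.1 x) = form v w

end Construction

end Petrov

end

open scoped Manifold ContDiff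

/-! On the simply transitive algebra all inner products are constant, so the Koszul formula is
purely algebraic. It gives `∇_u u = ∇_u v = 0`, `∇_v u = -Fv` and `∇_v w = δ⟨Fv, w⟩u`. Hence `R(u,
v)u = -F²v`, `R(u, v)w = δ⟨F²v, w⟩u`, `R(v, w)u = 0` and `R(v, w)z = δ(⟨Fw, z⟩Fv - ⟨Fv, z⟩Fw)`,
collected in `curvature_split`. Tracing gives `Ric(u, u) = -tr F²`, `Ric(u, v) = 0` and `Ric(v, w) =
-δ (tr F)⟨Fv, w⟩`.

The Einstein condition therefore forces `(tr F) F = (tr F²) Id` (`trace_smul_eq`), whence the three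
cases. If `F² = 0` and `dim V = 3`, then `F` has rank at most one and the skew expression `R(v, w)z`
vanishes. In case (iii) the component `(∇_v R)(u, v)z` equals `2δ(⟨Fv, z⟩F²v - ⟨F²v, z⟩Fv)`. Were it
zero, every nonzero `Fv` would be an eigenvector of `F`, so `F² = cF`, and `tr F = 0` would give `F²
= 0`.

The analytic part justifies computing `R` on fields of the algebra. The tensor is defined through
other local extensions, and the connection is not assumed smooth, so the existence of second
covariant derivatives (`DifferentiatesAt`) has to be derived from the frame. -/

namespace Petrov

open VectorField Filter
open scoped Topology

/-! ### Tensoriality of the curvature of a torsion-free connection -/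

section Tensoriality

variable {E : Type*} [NormedAddCommGroup E] [NormedSpace ℝ E]
  {M : Type*} [TopologicalSpace M] [ChartedSpace E M] [IsManifold 𝓘(ℝ, E) ∞ M]

/-- The connection differentiates `C²` vector fields at `x` into vector fields that are
differentiable at `x`. -/
def DifferentiatesAt (nabla : Connection E M) (x : M) : Prop :=
  ∀ X Z : Π x : M, TangentSpace 𝓘(ℝ, E) x, MDiffAt (T% X) x → CMDiffAt 2 (T% Z) x →
    MDiffAt (T% (fun y ↦ nabla Z y (X y))) x

variable {nabla : Connection E M} {x : M}
  {X X' Y Y' Z Z' : Π x : M, TangentSpace 𝓘(ℝ, E) x}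

lemma mdifferentiableAt_of_contMDiffAt_two (hX : CMDiffAt 2 (T% X) x) : MDiffAt (T% X) x :=
  hX.mdifferentiableAt two_ne_zero

/-- The torsion identity needs differentiability at each point where it is used; to differentiate it
covariantly at `x`, it must hold on a whole neighbourhood. -/
lemma eventually_mdifferentiableAt (hX : CMDiffAt 2 (T% X) x) :
    ∀ᶠ y in 𝓝 x, MDiffAt (T% X) y :=
  by
  have h2 : (2 : ℕ∞ω) ≠ ∞ := by decide
  exact ((contMDiffAt_iff_contMDiffAt_nhds h2).1 hX).mono fun _ h ↦ h.mdifferentiableAt two_ne_zero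

lemma nabla_sub (hY : MDiffAt (T% Y) x) (hZ : MDiffAt (T% Z) x) :
    nabla (Y - Z) x = nabla Y x - nabla Z x := by
  have h := nabla.isCovariantDerivativeOnUniv.add (mdifferentiableAt_sub_section hY hZ) hZ
  rw [sub_add_cancel] at h
  exact eq_sub_of_add_eq h.symm

lemma nabla_congr (hY : MDiffAt (T% Y) x) (hZ : MDiffAt (T% Z) x) (h : ∀ᶠ y in 𝓝 x, Y y = Z y) :
    nabla Y x = nabla Z x :=
  nabla.isCovariantDerivativeOnUniv.congr_of_eventuallyEq hY hZ univ_mem h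

lemma curvatureField_swap :
    curvatureField nabla X Y Z x = - curvatureField nabla Y X Z x := by
  simp only [curvatureField, mlieBracket_swap_apply (V := X) (W := Y), map_neg]
  abel

variable [FiniteDimensional ℝ E]

lemma mdifferentiableAt_mlieBracket (hX : CMDiffAt 2 (T% X) x) (hY : CMDiffAt 2 (T% Y) x) :
    MDiffAt (T% (mlieBracket 𝓘(ℝ, E) X Y)) x := by
  have h3 : (((2 : ℕ∞) : ℕ∞ω) + 1) ≤ ∞ := by decide
  have : IsManifold 𝓘(ℝ, E) (((2 : ℕ∞) : ℕ∞ω) + 1) M := .of_le h3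
  have : IsManifold 𝓘(ℝ, E) (minSmoothness ℝ 2) M := by
    rw [minSmoothness_of_isRCLikeNormedField]; infer_instance
  exact (ContMDiffAt.mlieBracket_vectorField (m := 1) (n := 2) hX hY
    (by simp [minSmoothness_of_isRCLikeNormedField]; norm_num)).mdifferentiableAt (by simp)

lemma nabla_sub_nabla (ht : nabla.torsion = 0) (hX : MDiffAt (T% X) x) (hY : MDiffAt (T% Y) x) :
    nabla Y x (X x) - nabla X x (Y x) = mlieBracket 𝓘(ℝ, E) X Y x :=
  nabla.torsion_eq_zero_iff.1 ht hX hY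

/-- Replacing `X` by `fX` adds `(Yf)∇_X Z` through the Leibniz rule, and the term `-(Yf)X` of `[fX,
Y]` cancels it. -/
lemma tensorialAt_curvatureField_left (hN : DifferentiatesAt nabla x)
    (hZ : CMDiffAt 2 (T% Z) x) :
    TensorialAt 𝓘(ℝ, E) E (curvatureField nabla · Y Z x) x where
  smul {f X} hf hX := by
    have h1 : (fun y ↦ nabla Z y ((f • X) y)) = f • fun y ↦ nabla Z y (X y) := by
      ext y; simp
    simp only [curvatureField]
    rw [h1, nabla.isCovariantDerivativeOnUniv.leibniz (hN X Z hX hZ) hf,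
      mlieBracket_smul_left hf hX]
    simp
    module
  add {X X'} hX hX' := by
    have h1 : (fun y ↦ nabla Z y ((X + X') y)) =
        (fun y ↦ nabla Z y (X y)) + fun y ↦ nabla Z y (X' y) := by
      ext y; simp
    simp only [curvatureField]
    rw [h1, nabla.isCovariantDerivativeOnUniv.add (hN X Z hX hZ) (hN X' Z hX' hZ),
      mlieBracket_add_left hX hX']
    simp
    abel

lemma curvatureField_congr_left (hN : DifferentiatesAt nabla x) (hZ : CMDiffAt 2 (T% Z) x)
    (hX : MDiffAt (T% X) x) (hX' : MDiffAt (T% X') x) (hY : MDiffAt (T% Y) x)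
    (hY' : MDiffAt (T% Y') x) (hXX' : X x = X' x) (hYY' : Y x = Y' x) :
    curvatureField nabla X Y Z x = curvatureField nabla X' Y' Z x := by
  rw [(tensorialAt_curvatureField_left hN hZ).pointwise hX hX' hXX', curvatureField_swap,
    (tensorialAt_curvatureField_left hN hZ).pointwise hY hY' hYY', ← curvatureField_swap]

/-- The first Bianchi identity. -/
lemma curvatureField_bianchi (ht : nabla.torsion = 0) (hN : DifferentiatesAt nabla x)
    (hX : CMDiffAt 2 (T% X) x) (hY : CMDiffAt 2 (T% Y) x) (hZ : CMDiffAt 2 (T% Z) x) :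
    curvatureField nabla X Y Z x + curvatureField nabla Y Z X x +
      curvatureField nabla Z X Y x = 0 := by
  have key {A B : Π x : M, TangentSpace 𝓘(ℝ, E) x} (hA : CMDiffAt 2 (T% A) x)
      (hB : CMDiffAt 2 (T% B) x) :
      nabla (fun y ↦ nabla B y (A y)) x - nabla (fun y ↦ nabla A y (B y)) x =
        nabla (mlieBracket 𝓘(ℝ, E) A B) x := by
    have hA' := mdifferentiableAt_of_contMDiffAt_two hA
    have hB' := mdifferentiableAt_of_contMDiffAt_two hB
    rw [← nabla_sub (hN A B hA' hB) (hN B A hB' hA)]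
    refine nabla_congr (mdifferentiableAt_sub_section (hN A B hA' hB) (hN B A hB' hA))
      (mdifferentiableAt_mlieBracket hA hB) ?_
    filter_upwards [eventually_mdifferentiableAt hA, eventually_mdifferentiableAt hB] with y h1 h2
    exact nabla_sub_nabla ht h1 h2
  have jac {A B C : Π x : M, TangentSpace 𝓘(ℝ, E) x} (hA : CMDiffAt 2 (T% A) x)
      (hB : CMDiffAt 2 (T% B) x) (hC : CMDiffAt 2 (T% C) x) :
      nabla (mlieBracket 𝓘(ℝ, E) A B) x (C x) - nabla C x (mlieBracket 𝓘(ℝ, E) A B x) =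
        mlieBracket 𝓘(ℝ, E) C (mlieBracket 𝓘(ℝ, E) A B) x :=
    nabla_sub_nabla ht (mdifferentiableAt_of_contMDiffAt_two hC)
      (mdifferentiableAt_mlieBracket hA hB)
  have h3 : (3 : ℕ∞ω) ≤ ∞ := by decide
  have : IsManifold 𝓘(ℝ, E) (minSmoothness ℝ 3) M := by
    rw [minSmoothness_of_isRCLikeNormedField]
    exact .of_le h3
  have h2 : minSmoothness ℝ 2 = 2 := minSmoothness_of_isRCLikeNormedField
  -- By torsion-freeness the cyclic sum of curvatures reduces to iterated brackets, so the Jacobi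
  -- identity finishes the proof.
  have hJ := leibniz_identity_mlieBracket_apply (h2.symm ▸ hY) (h2.symm ▸ hX) (h2.symm ▸ hZ)
  have hneg : mlieBracket 𝓘(ℝ, E) X (mlieBracket 𝓘(ℝ, E) Y Z) x =
      - mlieBracket 𝓘(ℝ, E) X (mlieBracket 𝓘(ℝ, E) Z Y) x := by
    rw [mlieBracket_swap (V := Y) (W := Z), ← neg_one_smul ℝ (mlieBracket 𝓘(ℝ, E) Z Y),
      mlieBracket_const_smul_right (mdifferentiableAt_mlieBracket hZ hY), neg_one_smul]
  rw [hneg, mlieBracket_swap_apply (V := mlieBracket 𝓘(ℝ, E) Y X)] at hJ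
  have e1 := congr($(key hX hZ) (Y x))
  have e2 := congr($(key hY hX) (Z x))
  have e3 := congr($(key hZ hY) (X x))
  have j1 := jac hX hZ hY
  have j2 := jac hY hX hZ
  have j3 := jac hZ hY hX
  simp only [sub_apply] at e1 e2 e3
  simp only [curvatureField, mlieBracket_swap_apply (V := X) (W := Y),
    mlieBracket_swap_apply (V := Y) (W := Z), mlieBracket_swap_apply (V := Z) (W := X), map_neg]
  rw [← e1] at j1
  rw [← e2] at j2
  rw [← e3] at j3
  rw [← j1, ← j2, ← j3] at hJ
  linear_combination (norm := module) hJ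

/-- The value of `R(X, Y)Z` at `x` depends only on the values of `X`, `Y`, `Z` at `x`. -/
lemma curvatureField_congr (ht : nabla.torsion = 0) (hN : DifferentiatesAt nabla x)
    (hX : CMDiffAt 2 (T% X) x) (hX' : CMDiffAt 2 (T% X') x) (hY : CMDiffAt 2 (T% Y) x)
    (hY' : CMDiffAt 2 (T% Y') x) (hZ : CMDiffAt 2 (T% Z) x) (hZ' : CMDiffAt 2 (T% Z') x)
    (hXX' : X x = X' x) (hYY' : Y x = Y' x) (hZZ' : Z x = Z' x) :
    curvatureField nabla X Y Z x = curvatureField nabla X' Y' Z' x := by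
  have dX := mdifferentiableAt_of_contMDiffAt_two hX
  have dX' := mdifferentiableAt_of_contMDiffAt_two hX'
  have dY := mdifferentiableAt_of_contMDiffAt_two hY
  have dY' := mdifferentiableAt_of_contMDiffAt_two hY'
  have dZ := mdifferentiableAt_of_contMDiffAt_two hZ
  have dZ' := mdifferentiableAt_of_contMDiffAt_two hZ'
  rw [curvatureField_congr_left hN hZ dX dX' dY dY' hXX' hYY']
  -- In the other two terms of the cyclic sum, `Z` stands in a slot already known to be tensorial.
  -- No second derivatives of coefficient functions are needed.
  have b := curvatureField_bianchi ht hN hX' hY' hZ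
  have b' := curvatureField_bianchi ht hN hX' hY' hZ'
  rw [curvatureField_congr_left hN hX' dY' dY' dZ dZ' rfl hZZ',
    curvatureField_congr_left hN hY' dZ dZ' dX' dX' hZZ' rfl, ← b', add_left_inj,
    add_left_inj] at b
  exact b

/-- The curvature tensor evaluated on the values of `C²` vector fields. -/
lemma curvature_apply (ht : nabla.torsion = 0) (hN : DifferentiatesAt nabla x)
    (hX : CMDiffAt 2 (T% X) x) (hY : CMDiffAt 2 (T% Y) x) (hZ : CMDiffAt 2 (T% Z) x) :
    curvature nabla x (X x) (Y x) (Z x) = curvatureField nabla X Y Z x := by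
  let T (a b c : TangentSpace 𝓘(ℝ, E) x) : TangentSpace 𝓘(ℝ, E) x :=
    curvatureField nabla (FiberBundle.extend E a) (FiberBundle.extend E b)
      (FiberBundle.extend E c) x
  have hC (a : TangentSpace 𝓘(ℝ, E) x) : CMDiffAt 2 (T% (FiberBundle.extend E a)) x :=
    FiberBundle.contMDiffAt_extend ..
  have hM (a : TangentSpace 𝓘(ℝ, E) x) : MDiffAt (T% (FiberBundle.extend E a)) x :=
    mdifferentiableAt_of_contMDiffAt_two (hC a)
  have add₁ (a a' b c) : T (a + a') b c = T a b c + T a' b c := by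
    have h := tensorialAt_curvatureField_left (Y := FiberBundle.extend E b) hN (hC c)
    rw [← h.add (hM a) (hM a')]
    exact h.pointwise (hM _) (mdifferentiableAt_add_section (hM a) (hM a')) (by simp)
  have smul₁ (r : ℝ) (a b c) : T (r • a) b c = r • T a b c := by
    have h := tensorialAt_curvatureField_left (Y := FiberBundle.extend E b) hN (hC c)
    have hr : MDiffAt (fun _ : M ↦ r) x := mdifferentiableAt_const
    rw [← h.smul hr (hM a)]
    exact h.pointwise (hM _) (hr.smul_section (hM a)) (by simp)
  have swap (a b c) : T a b c = - T b a c := curvatureField_swap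
  have add₂ (a b b' c) : T a (b + b') c = T a b c + T a b' c := by
    rw [swap, add₁, swap b, swap b']
    abel
  have smul₂ (r : ℝ) (a b c) : T a (r • b) c = r • T a b c := by
    rw [swap, smul₁, swap b, smul_neg, neg_neg]
  -- Linearity in the third slot is inherited from the first two.
  have bianchi (a b c) : T a b c = - T b c a - T c a b := by
    have h : T a b c + T b c a + T c a b = 0 :=
      curvatureField_bianchi ht hN (hC a) (hC b) (hC c)
    linear_combination (norm := module) h
  have add₃ (a b c c') : T a b (c + c') = T a b c + T a b c' := by
    simp only [bianchi a b, add₁, add₂]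
    abel
  have smul₃ (r : ℝ) (a b c) : T a b (r • c) = r • T a b c := by
    simp only [bianchi a b, smul₁, smul₂]
    module
  let L : TangentSpace 𝓘(ℝ, E) x →ₗ[ℝ] TangentSpace 𝓘(ℝ, E) x →ₗ[ℝ]
      TangentSpace 𝓘(ℝ, E) x →ₗ[ℝ] TangentSpace 𝓘(ℝ, E) x :=
    { toFun a := LinearMap.mk₂ ℝ (T a) (add₂ a) (fun r b c ↦ smul₂ r a b c) (add₃ a)
        (fun r b c ↦ smul₃ r a b c)
      map_add' a a' := by ext b c; exact add₁ a a' b c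
      map_smul' r a := by ext b c; exact smul₁ r a b c }
  have hL : curvature nabla x = L := by
    let e := Module.finBasis ℝ (TangentSpace 𝓘(ℝ, E) x)
    refine e.ext fun i ↦ e.ext fun j ↦ e.ext fun k ↦ ?_
    simp only [curvature, e, Module.Basis.constr_basis]
    rfl
  rw [hL]
  exact curvatureField_congr ht hN (hC _) hX (hC _) hY (hC _) hZ (by simp) (by simp) (by simp)

end Tensoriality

/-! ### Differentiability of covariant derivatives, from a frame -/

section Frame

variable {E : Type*} [NormedAddCommGroup E] [NormedSpace ℝ E]
  {M : Type*} [TopologicalSpace M] [ChartedSpace E M] [IsManifold 𝓘(ℝ, E) ∞ M]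

lemma PseudoRiemannianMetric.mdifferentiableAt_inner (g : PseudoRiemannianMetric E M) {x : M}
    {X Y : Π x : M, TangentSpace 𝓘(ℝ, E) x} (hX : MDiffAt (T% X) x) (hY : MDiffAt (T% Y) x) :
    MDiffAt (fun y ↦ g.inner y (X y) (Y y)) x := by
  have hg := (g.contMDiff x).mdifferentiableAt (by simp)
  have h := MDifferentiableAt.clm_bundle_apply₂ (F₁ := E) (F₂ := E) (F₃ := ℝ)
    (E₃ := Bundle.Trivial M ℝ) hg hX hY
  rw [mdifferentiableAt_totalSpace] at h
  exact h.2

variable [FiniteDimensional ℝ E]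

/-- A torsion-free connection differentiates `C²` vector fields at `x` if the covariant derivatives
of the members of a frame along each other are differentiable at `x`. -/
lemma differentiatesAt_of_frame {nabla : Connection E M} {x : M} (ht : nabla.torsion = 0)
    {ι : Type*} [Fintype ι] {w : ι → Π x : M, TangentSpace 𝓘(ℝ, E) x}
    (hw : ∀ i, CMDiffAt 2 (T% (w i)) x)
    (hcoeff : ∀ X : Π x : M, TangentSpace 𝓘(ℝ, E) x, MDiffAt (T% X) x →
      ∃ a : ι → M → ℝ, (∀ i, MDiffAt (a i) x) ∧ ∀ y, X y = ∑ i, a i y • w i y)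
    (hcov : ∀ i j, MDiffAt (T% (fun y ↦ nabla (w j) y (w i y))) x) :
    DifferentiatesAt nabla x := by
  have of_frame {Z : Π x : M, TangentSpace 𝓘(ℝ, E) x}
      (hZ : ∀ i, MDiffAt (T% (fun y ↦ nabla Z y (w i y))) x)
      {X : Π x : M, TangentSpace 𝓘(ℝ, E) x} (hX : MDiffAt (T% X) x) :
      MDiffAt (T% (fun y ↦ nabla Z y (X y))) x := by
    obtain ⟨a, ha, hXa⟩ := hcoeff X hX
    have h : MDiffAt (T% (fun y ↦ ∑ i, (a i • fun y ↦ nabla Z y (w i y)) y)) x :=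
      .sum_section fun i _ ↦ (ha i).smul_section (hZ i)
    refine h.congr_of_eventuallyEq (.of_forall fun y ↦ ?_)
    simp [hXa y]
  intro X Z hX hZ
  refine of_frame (fun i ↦ ?_) hX
  -- Torsion-freeness gives `∇_{w i} Z = ∇_Z (w i) + [w i, Z]`, so that only frame members are
  -- differentiated by the connection.
  have h := mdifferentiableAt_add_section
    (of_frame (hcov · i) (mdifferentiableAt_of_contMDiffAt_two hZ))
    (mdifferentiableAt_mlieBracket (hw i) hZ)
  refine h.congr_of_eventuallyEq ?_
  filter_upwards [eventually_mdifferentiableAt (hw i), eventually_mdifferentiableAt hZ]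
    with y h1 h2
  rw [Pi.add_apply, ← nabla_sub_nabla ht h1 h2, add_sub_cancel]

end Frame

/-! ### Simply transitive algebras as global frames -/

namespace IsSimplyTransitive

variable {E : Type*} [NormedAddCommGroup E] [NormedSpace ℝ E]
  {M : Type*} [TopologicalSpace M] [ChartedSpace E M] [IsManifold 𝓘(ℝ, E) ∞ M]
  {𝒳 : Submodule ℝ (Π x : M, TangentSpace 𝓘(ℝ, E) x)}

/-- Evaluation at `x`, as a linear isomorphism. -/
noncomputable def evalEquiv (h : IsSimplyTransitive 𝒳) (x : M) :
    𝒳 ≃ₗ[ℝ] TangentSpace 𝓘(ℝ, E) x :=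
  .ofBijective (LinearMap.proj x ∘ₗ 𝒳.subtype) (h.bijective_eval x)

@[simp]
lemma evalEquiv_apply (h : IsSimplyTransitive 𝒳) (x : M) (w : 𝒳) : h.evalEquiv x w = w.1 x := rfl

lemma contMDiffAt (h : IsSimplyTransitive 𝒳) (w : 𝒳) (x : M) : CMDiffAt 2 (T% w.1) x :=
  ((h.smooth w.1 w.2) x).of_le (by decide)

lemma mdifferentiableAt (h : IsSimplyTransitive 𝒳) (w : 𝒳) (x : M) : MDiffAt (T% w.1) x :=
  mdifferentiableAt_of_contMDiffAt_two (h.contMDiffAt w x)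

/-- The coefficients of a differentiable vector field relative to a basis of a simply transitive
Lie algebra of vector fields are differentiable, if some metric is constant on that algebra. -/
lemma exists_coeff (h : IsSimplyTransitive 𝒳) (g : PseudoRiemannianMetric E M)
    {G : LinearMap.BilinForm ℝ 𝒳} (hG : ∀ x w w', g.inner x (w.1 x) (w'.1 x) = G w w')
    (hG' : G.Nondegenerate) {ι : Type*} [Fintype ι] [DecidableEq ι] (b : Module.Basis ι ℝ 𝒳)
    {x : M} (X : Π x : M, TangentSpace 𝓘(ℝ, E) x) (hX : MDiffAt (T% X) x) :
    ∃ a : ι → M → ℝ, (∀ i, MDiffAt (a i) x) ∧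
      ∀ y, X y = ∑ i, a i y • (G.dualBasis hG' b i).1 y := by
  -- Relative to the dual basis the coefficients are inner products of `X` with the `b i`, so they
  -- inherit differentiability from `g` and `X`.
  refine ⟨fun i y ↦ g.inner y (X y) ((b i).1 y),
    fun i ↦ g.mdifferentiableAt_inner hX (h.mdifferentiableAt _ _), fun y ↦ ?_⟩
  obtain ⟨w, hw⟩ := (h.evalEquiv y).surjective (X y)
  have hs := congr(h.evalEquiv y $((G.dualBasis hG' b).sum_repr w))
  simp only [map_sum, map_smul, LinearMap.BilinForm.dualBasis_repr_apply, ← hG y, evalEquiv_apply]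
    at hs hw
  rw [hw] at hs
  exact hs.symm

end IsSimplyTransitive

/-- The trace of an endomorphism of a product is the sum of the traces of its diagonal blocks. -/
lemma trace_prod_eq {W : Type*} [AddCommGroup W] [Module ℝ W] [FiniteDimensional ℝ W]
    (B : ℝ × W →ₗ[ℝ] ℝ × W) :
    LinearMap.trace ℝ _ B = (B (1, 0)).1 +
      LinearMap.trace ℝ _ (LinearMap.snd ℝ ℝ W ∘ₗ B ∘ₗ LinearMap.inr ℝ ℝ W) := by
  have h0 : B (0, 0) = 0 := B.map_zero
  have hB : B = (LinearMap.fst ℝ ℝ W).smulRight (B (1, 0)) +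
      (B ∘ₗ LinearMap.inr ℝ ℝ W) ∘ₗ LinearMap.snd ℝ ℝ W := by
    ext <;> simp [h0]
  conv_lhs => rw [hB]
  rw [map_add, LinearMap.trace_smulRight, LinearMap.trace_comp_comm']
  rfl

/-! ### The splitting `ℝu ⊕ V` and the Koszul formula -/

namespace IsPetrovData

set_option maxSynthPendingDepth 6

variable {E : Type*} [NormedAddCommGroup E] [NormedSpace ℝ E]
  {M : Type*} [TopologicalSpace M] [ChartedSpace E M] [IsManifold 𝓘(ℝ, E) ∞ M]
  {𝒳 : Submodule ℝ (Π x : M, TangentSpace 𝓘(ℝ, E) x)} {V : Submodule ℝ 𝒳} {u : 𝒳}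
  {form : LinearMap.BilinForm ℝ V} {F : V →ₗ[ℝ] V} {δ : ℝ}

lemma finite (hd : IsPetrovData 𝒳 V u form F δ) : Module.Finite ℝ 𝒳 :=
  Module.finite_of_finrank_pos (hd.codim_one ▸ Nat.succ_pos _)

lemma split_injective (hd : IsPetrovData 𝒳 V u form F δ) :
    Function.Injective ((LinearMap.toSpanSingleton ℝ 𝒳 u).coprod V.subtype) := by
  refine (injective_iff_map_eq_zero _).2 fun ⟨r, v⟩ hp ↦ ?_
  simp only [LinearMap.coprod_apply, LinearMap.toSpanSingleton_apply,
    Submodule.subtype_apply] at hp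
  have hr : r = 0 := by
    by_contra hr
    refine hd.u_notMem ((V.smul_mem_iff hr).1 ?_)
    rw [eq_neg_of_add_eq_zero_left hp]
    exact V.neg_mem v.2
  subst hr
  simpa using hp

lemma split_bijective (hd : IsPetrovData 𝒳 V u form F δ) :
    Function.Bijective ((LinearMap.toSpanSingleton ℝ 𝒳 u).coprod V.subtype) := by
  have := hd.finite
  have h : Module.finrank ℝ (ℝ × V) = Module.finrank ℝ 𝒳 := by
    rw [Module.finrank_prod, Module.finrank_self, ← hd.codim_one, add_comm]
  exact ⟨hd.split_injective,
    (LinearMap.injective_iff_surjective_of_finrank_eq_finrank h).1 hd.split_injective⟩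

/-- The isomorphism `(r, v) ↦ r u + v`. -/
noncomputable def splitEquiv (hd : IsPetrovData 𝒳 V u form F δ) : (ℝ × V) ≃ₗ[ℝ] 𝒳 :=
  .ofBijective _ hd.split_bijective

lemma splitEquiv_apply (hd : IsPetrovData 𝒳 V u form F δ) (r : ℝ) (v : V) :
    hd.splitEquiv (r, v) = r • u + v := by simp [splitEquiv]

/-- The isomorphism `(r, v) ↦ r u(x) + v(x)` onto the tangent space at `x`. -/
noncomputable def tangentEquiv (hd : IsPetrovData 𝒳 V u form F δ) (x : M) :
    (ℝ × V) ≃ₗ[ℝ] TangentSpace 𝓘(ℝ, E) x :=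
  hd.splitEquiv.trans (hd.simplyTransitive.evalEquiv x)

lemma tangentEquiv_apply (hd : IsPetrovData 𝒳 V u form F δ) (x : M) (r : ℝ) (v : V) :
    hd.tangentEquiv x (r, v) = r • u.1 x + v.1.1 x := by
  simp [tangentEquiv, splitEquiv_apply]

lemma tangentEquiv_symm_apply (hd : IsPetrovData 𝒳 V u form F δ) (x : M) (r : ℝ) (v : V) :
    (hd.tangentEquiv x).symm (r • u.1 x + v.1.1 x) = (r, v) := by
  rw [← tangentEquiv_apply hd, LinearEquiv.symm_apply_apply]

lemma exists_eq_smul_add (hd : IsPetrovData 𝒳 V u form F δ) (w : 𝒳) :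
    ∃ (r : ℝ) (v : V), w = r • u + v := by
  obtain ⟨⟨r, v⟩, h⟩ := hd.splitEquiv.surjective w
  exact ⟨r, v, h.symm.trans (hd.splitEquiv_apply r v)⟩

lemma exists_tangent_eq (hd : IsPetrovData 𝒳 V u form F δ) {x : M} (a : TangentSpace 𝓘(ℝ, E) x) :
    ∃ (r : ℝ) (v : V), a = r • u.1 x + v.1.1 x := by
  obtain ⟨⟨r, v⟩, h⟩ := (hd.tangentEquiv x).surjective a
  exact ⟨r, v, h.symm.trans (hd.tangentEquiv_apply x r v)⟩

lemma delta_sq (hd : IsPetrovData 𝒳 V u form F δ) : δ * δ = 1 := by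
  rcases hd.sign with h | h <;> simp [h]

variable {g : PseudoRiemannianMetric E M}

lemma _root_.Petrov.IsPetrovMetric.inner_eq (hg : IsPetrovMetric g u form δ) (x : M) (r s : ℝ) (v w : V) :
    g.inner x (r • u.1 x + v.1.1 x) (s • u.1 x + w.1.1 x) = r * s * δ + form v w := by
  have h : g.inner x (v.1.1 x) (u.1 x) = 0 := by rw [g.symm, hg.inner_u_V]
  simp [hg.inner_u_u, hg.inner_u_V, hg.inner_V_V, h]
  ring

lemma inner_const (hd : IsPetrovData 𝒳 V u form F δ)
    (hg : IsPetrovMetric g u form δ) (x y : M) (w w' : 𝒳) :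
    g.inner x (w.1 x) (w'.1 x) = g.inner y (w.1 y) (w'.1 y) := by
  obtain ⟨r, v, rfl⟩ := hd.exists_eq_smul_add w
  obtain ⟨s, v', rfl⟩ := hd.exists_eq_smul_add w'
  exact (hg.inner_eq x r s v v').trans (hg.inner_eq y r s v v').symm

lemma eq_of_inner_eq (hd : IsPetrovData 𝒳 V u form F δ) {x : M} {a b : TangentSpace 𝓘(ℝ, E) x}
    (hu : g.inner x a (u.1 x) = g.inner x b (u.1 x))
    (hV : ∀ v : V, g.inner x a (v.1.1 x) = g.inner x b (v.1.1 x)) : a = b := by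
  refine sub_eq_zero.1 (g.nondegenerate x _ fun c ↦ ?_)
  obtain ⟨r, v, rfl⟩ := hd.exists_tangent_eq c
  simp [hu, hV]

variable [FiniteDimensional ℝ E] {nabla : Connection E M}

/-- The inner product of two fields of the algebra is constant, so the left side of the equation `∇g
= 0` vanishes. -/
lemma inner_nabla_skew (hd : IsPetrovData 𝒳 V u form F δ)
    (hg : IsPetrovMetric g u form δ) (hn : IsLeviCivita g nabla) (x : M) (w w' w'' : 𝒳) :
    g.inner x (nabla w'.1 x (w.1 x)) (w''.1 x) = - g.inner x (nabla w''.1 x (w.1 x)) (w'.1 x) := by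
  have h := hn.metric x w'.1 w''.1 (hd.simplyTransitive.mdifferentiableAt _ _)
    (hd.simplyTransitive.mdifferentiableAt _ _) (w.1 x)
  have hc : (fun y ↦ g.inner y (w'.1 y) (w''.1 y)) = fun _ ↦ g.inner x (w'.1 x) (w''.1 x) :=
    funext fun y ↦ hd.inner_const hg y x w' w''
  rw [hc, mvfderiv_const, g.symm x (w'.1 x)] at h
  simp only [zero_apply] at h
  linarith

lemma nabla_swap (hd : IsPetrovData 𝒳 V u form F δ) (hn : IsLeviCivita g nabla)
    (x : M) (w w' : 𝒳) :
    nabla w'.1 x (w.1 x) = nabla w.1 x (w'.1 x) + mlieBracket 𝓘(ℝ, E) w.1 w'.1 x := by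
  rw [← nabla_sub_nabla hn.torsion_eq_zero (hd.simplyTransitive.mdifferentiableAt _ _)
    (hd.simplyTransitive.mdifferentiableAt _ _)]
  abel

/-- The Koszul formula on a Lie algebra of vector fields on which the metric is constant. -/
lemma inner_nabla (hd : IsPetrovData 𝒳 V u form F δ)
    (hg : IsPetrovMetric g u form δ) (hn : IsLeviCivita g nabla) (x : M) (w w' w'' : 𝒳) :
    2 * g.inner x (nabla w'.1 x (w.1 x)) (w''.1 x) =
      g.inner x (mlieBracket 𝓘(ℝ, E) w.1 w'.1 x) (w''.1 x) -
      g.inner x (mlieBracket 𝓘(ℝ, E) w'.1 w''.1 x) (w.1 x) +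
      g.inner x (mlieBracket 𝓘(ℝ, E) w''.1 w.1 x) (w'.1 x) := by
  -- The usual Koszul elimination: three cyclic metric identities against three cyclic torsion
  -- identities.
  have s1 := hd.inner_nabla_skew hg hn x w w' w''
  have s2 := hd.inner_nabla_skew hg hn x w' w'' w
  have s3 := hd.inner_nabla_skew hg hn x w'' w w'
  have t1 := hd.nabla_swap hn x w w'
  have t2 := hd.nabla_swap hn x w' w''
  have t3 := hd.nabla_swap hn x w'' w
  have t1' := congr(g.inner x $t1 (w''.1 x))
  have t2' := congr(g.inner x $t2 (w.1 x))
  have t3' := congr(g.inner x $t3 (w'.1 x))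
  simp only [map_add, add_apply] at t1' t2' t3'
  linarith

end IsPetrovData

namespace IsPetrovData

set_option maxSynthPendingDepth 6

variable {E : Type*} [NormedAddCommGroup E] [NormedSpace ℝ E]
  {M : Type*} [TopologicalSpace M] [ChartedSpace E M] [IsManifold 𝓘(ℝ, E) ∞ M]
  {𝒳 : Submodule ℝ (Π x : M, TangentSpace 𝓘(ℝ, E) x)} {V : Submodule ℝ 𝒳} {u : 𝒳}
  {form : LinearMap.BilinForm ℝ V} {F : V →ₗ[ℝ] V} {δ : ℝ}
  {g : PseudoRiemannianMetric E M} {nabla : Connection E M}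

lemma bracket_V_u (hd : IsPetrovData 𝒳 V u form F δ) (v : V) :
    mlieBracket 𝓘(ℝ, E) v.1.1 u.1 = -(F v).1.1 := by
  rw [mlieBracket_swap, hd.bracket_u]

lemma nabla_smul (hd : IsPetrovData 𝒳 V u form F δ) (r : ℝ) (w : 𝒳) (x : M) :
    nabla (fun y ↦ r • w.1 y) x = r • nabla w.1 x :=
  nabla.isCovariantDerivativeOnUniv.smul_const r (hd.simplyTransitive.mdifferentiableAt w x)

lemma nabla_neg (hd : IsPetrovData 𝒳 V u form F δ) (w : 𝒳) (x : M) :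
    nabla (fun y ↦ - w.1 y) x = - nabla w.1 x := by
  simpa using hd.nabla_smul (nabla := nabla) (-1) w x

lemma nabla_fun_zero (x : M) : nabla (fun _ ↦ 0) x = 0 :=
  nabla.isCovariantDerivativeOnUniv.zero

variable [FiniteDimensional ℝ E]

/-! ### The Levi-Civita connection on the algebra -/

section Connection

lemma nabla_u_u (hd : IsPetrovData 𝒳 V u form F δ) (hg : IsPetrovMetric g u form δ)
    (hn : IsLeviCivita g nabla) (x : M) : nabla u.1 x (u.1 x) = 0 := by
  refine hd.eq_of_inner_eq (g := g) ?_ fun v ↦ ?_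
  · have h := hd.inner_nabla hg hn x u u u
    simpa using h
  · have h := hd.inner_nabla hg hn x u u v
    rw [mlieBracket_self, hd.bracket_u, hd.bracket_V_u] at h
    have h' : g.inner x ((F v).1.1 x) (u.1 x) = 0 := by rw [g.symm, hg.inner_u_V]
    simpa [h'] using h

/-- The `V`-component is half of `⟨Fv, w⟩ - ⟨Fw, v⟩`, which is zero because `F` is self-adjoint. -/
lemma nabla_u_V (hd : IsPetrovData 𝒳 V u form F δ) (hg : IsPetrovMetric g u form δ)
    (hn : IsLeviCivita g nabla) (x : M) (v : V) : nabla v.1.1 x (u.1 x) = 0 := by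
  refine hd.eq_of_inner_eq (g := g) ?_ fun w ↦ ?_
  · rw [hd.inner_nabla_skew hg hn, hd.nabla_u_u hg hn]
    simp
  · have h := hd.inner_nabla hg hn x u v w
    rw [hd.bracket_u, hd.bracket_V, hd.bracket_V_u, hg.inner_V_V] at h
    simp only [Pi.neg_apply, Pi.zero_apply, map_zero, map_neg, zero_apply, neg_apply,
      hg.inner_V_V, hd.selfAdjoint v w, hd.symm (F w) v] at h ⊢
    linarith

lemma nabla_V_u (hd : IsPetrovData 𝒳 V u form F δ) (hg : IsPetrovMetric g u form δ)
    (hn : IsLeviCivita g nabla) (x : M) (v : V) : nabla u.1 x (v.1.1 x) = -(F v).1.1 x := by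
  rw [hd.nabla_swap hn, hd.nabla_u_V hg hn, hd.bracket_V_u, zero_add, Pi.neg_apply]

lemma nabla_V_V (hd : IsPetrovData 𝒳 V u form F δ) (hg : IsPetrovMetric g u form δ)
    (hn : IsLeviCivita g nabla) (x : M) (v w : V) :
    nabla w.1.1 x (v.1.1 x) = (δ * form (F v) w) • u.1 x := by
  refine hd.eq_of_inner_eq (g := g) ?_ fun z ↦ ?_
  · rw [hd.inner_nabla_skew hg hn, hd.nabla_V_u hg hn]
    simp only [map_neg, neg_apply, neg_neg, map_smul, smul_apply, hg.inner_u_u, hg.inner_V_V,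
      smul_eq_mul]
    linear_combination (-form (F v) w) * hd.delta_sq
  · have h := hd.inner_nabla hg hn x v w z
    rw [hd.bracket_V, hd.bracket_V, hd.bracket_V] at h
    simp only [Pi.zero_apply, map_zero, zero_apply] at h
    simp only [map_smul, smul_apply, hg.inner_u_V]
    simpa using h

/-- The Lie algebra is closed under covariant differentiation. -/
lemma exists_nabla_eq (hd : IsPetrovData 𝒳 V u form F δ) (hg : IsPetrovMetric g u form δ)
    (hn : IsLeviCivita g nabla) (w w' : 𝒳) :
    ∃ z : 𝒳, ∀ x, nabla w'.1 x (w.1 x) = z.1 x := by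
  obtain ⟨r, v, rfl⟩ := hd.exists_eq_smul_add w
  obtain ⟨s, v', rfl⟩ := hd.exists_eq_smul_add w'
  refine ⟨(δ * form (F v) v') • u - s • (F v).1, fun x ↦ ?_⟩
  have hu := hd.simplyTransitive.mdifferentiableAt u x
  have hv := hd.simplyTransitive.mdifferentiableAt v'.1 x
  have h : nabla (s • u + v'.1).1 x = s • nabla u.1 x + nabla v'.1.1 x := by
    rw [← nabla.isCovariantDerivativeOnUniv.smul_const s hu]
    exact nabla.isCovariantDerivativeOnUniv.add hu.smul_const_section hv
  rw [h]
  simp [hd.nabla_u_u hg hn, hd.nabla_u_V hg hn, hd.nabla_V_u hg hn, hd.nabla_V_V hg hn]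
  abel

/-- A basis of `𝒳` is a smooth frame whose mutual covariant derivatives stay in `𝒳`, hence are
smooth; this is what `differentiatesAt_of_frame` requires. -/
lemma differentiatesAt (hd : IsPetrovData 𝒳 V u form F δ) (hg : IsPetrovMetric g u form δ)
    (hn : IsLeviCivita g nabla) (x : M) : DifferentiatesAt nabla x := by
  have := hd.finite
  let ev := (hd.simplyTransitive.evalEquiv x).toLinearMap
  let G : LinearMap.BilinForm ℝ 𝒳 :=
    LinearMap.mk₂ ℝ (fun w w' ↦ g.inner x (ev w) (ev w'))
      (by simp) (by simp) (by simp) (by simp)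
  have hG : ∀ y w w', g.inner y (w.1 y) (w'.1 y) = G w w' := fun y w w' ↦
    hd.inner_const hg y x w w'
  have hleft : ∀ w, (∀ w', G w w' = 0) → w = 0 := fun w hw ↦ by
    refine (hd.simplyTransitive.evalEquiv x).injective ?_
    rw [map_zero]
    refine g.nondegenerate x _ fun a ↦ ?_
    obtain ⟨w', rfl⟩ := (hd.simplyTransitive.evalEquiv x).surjective a
    exact hw w'
  have hG' : G.Nondegenerate := ⟨hleft, fun w hw ↦ hleft w fun w' ↦ by
    rw [← hw w']; exact g.symm x _ _⟩
  let b := Module.finBasis ℝ 𝒳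
  refine differentiatesAt_of_frame hn.torsion_eq_zero
    (w := fun i ↦ (G.dualBasis hG' b i).1)
    (fun i ↦ hd.simplyTransitive.contMDiffAt _ _)
    (fun X hX ↦ hd.simplyTransitive.exists_coeff g hG hG' b X hX) fun i j ↦ ?_
  obtain ⟨z, hz⟩ := hd.exists_nabla_eq hg hn (G.dualBasis hG' b i) (G.dualBasis hG' b j)
  simp only [hz]
  exact hd.simplyTransitive.mdifferentiableAt z x

lemma curvature_eq (hd : IsPetrovData 𝒳 V u form F δ) (hg : IsPetrovMetric g u form δ)
    (hn : IsLeviCivita g nabla) (x : M) (w w' w'' : 𝒳) :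
    curvature nabla x (w.1 x) (w'.1 x) (w''.1 x) = curvatureField nabla w.1 w'.1 w''.1 x :=
  curvature_apply hn.torsion_eq_zero (hd.differentiatesAt hg hn x)
    (hd.simplyTransitive.contMDiffAt _ _) (hd.simplyTransitive.contMDiffAt _ _)
    (hd.simplyTransitive.contMDiffAt _ _)

end Connection

/-! ### The curvature tensor -/

section Curvature

lemma curvature_V_V_V (hd : IsPetrovData 𝒳 V u form F δ) (hg : IsPetrovMetric g u form δ)
    (hn : IsLeviCivita g nabla) (x : M) (v w z : V) :
    curvature nabla x (v.1.1 x) (w.1.1 x) (z.1.1 x) =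
      (δ * form (F w) z) • (F v).1.1 x - (δ * form (F v) z) • (F w).1.1 x := by
  rw [hd.curvature_eq hg hn]
  simp only [curvatureField, hd.nabla_V_V hg hn, hd.nabla_smul, hd.bracket_V, smul_apply,
    hd.nabla_V_u hg hn, Pi.zero_apply, map_zero]
  module

lemma curvature_V_V_u (hd : IsPetrovData 𝒳 V u form F δ) (hg : IsPetrovMetric g u form δ)
    (hn : IsLeviCivita g nabla) (x : M) (v w : V) :
    curvature nabla x (v.1.1 x) (w.1.1 x) (u.1 x) = 0 := by
  rw [hd.curvature_eq hg hn]
  simp only [curvatureField, hd.nabla_V_V hg hn, hd.nabla_neg, hd.bracket_V, neg_apply,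
    hd.nabla_V_u hg hn, Pi.zero_apply, map_zero, hd.symm (F w)]
  module

lemma curvature_u_V_u (hd : IsPetrovData 𝒳 V u form F δ) (hg : IsPetrovMetric g u form δ)
    (hn : IsLeviCivita g nabla) (x : M) (v : V) :
    curvature nabla x (u.1 x) (v.1.1 x) (u.1 x) = -(F (F v)).1.1 x := by
  rw [hd.curvature_eq hg hn]
  simp only [curvatureField, hd.nabla_u_u hg hn, hd.nabla_u_V hg hn, hd.nabla_neg, hd.bracket_u,
    neg_apply, hd.nabla_V_u hg hn, nabla_fun_zero, zero_apply]
  module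

lemma curvature_u_V_V (hd : IsPetrovData 𝒳 V u form F δ) (hg : IsPetrovMetric g u form δ)
    (hn : IsLeviCivita g nabla) (x : M) (v w : V) :
    curvature nabla x (u.1 x) (v.1.1 x) (w.1.1 x) = (δ * form (F (F v)) w) • u.1 x := by
  rw [hd.curvature_eq hg hn]
  simp only [curvatureField, hd.nabla_u_V hg hn, hd.nabla_V_V hg hn, hd.nabla_smul, hd.bracket_u,
    smul_apply, hd.nabla_u_u hg hn, nabla_fun_zero, zero_apply]
  module

lemma curvature_swap (hd : IsPetrovData 𝒳 V u form F δ) (hg : IsPetrovMetric g u form δ)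
    (hn : IsLeviCivita g nabla) (x : M) (w w' w'' : 𝒳) :
    curvature nabla x (w.1 x) (w'.1 x) (w''.1 x) =
      - curvature nabla x (w'.1 x) (w.1 x) (w''.1 x) := by
  rw [hd.curvature_eq hg hn, hd.curvature_eq hg hn, curvatureField_swap]

lemma curvature_V_u_V (hd : IsPetrovData 𝒳 V u form F δ) (hg : IsPetrovMetric g u form δ)
    (hn : IsLeviCivita g nabla) (x : M) (v w : V) :
    curvature nabla x (v.1.1 x) (u.1 x) (w.1.1 x) = -((δ * form (F (F v)) w) • u.1 x) := by
  rw [hd.curvature_swap hg hn, hd.curvature_u_V_V hg hn]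

lemma curvature_V_u_u (hd : IsPetrovData 𝒳 V u form F δ) (hg : IsPetrovMetric g u form δ)
    (hn : IsLeviCivita g nabla) (x : M) (v : V) :
    curvature nabla x (v.1.1 x) (u.1 x) (u.1 x) = (F (F v)).1.1 x := by
  rw [hd.curvature_swap hg hn, hd.curvature_u_V_u hg hn, neg_neg]

lemma curvature_u_u (hd : IsPetrovData 𝒳 V u form F δ) (hg : IsPetrovMetric g u form δ)
    (hn : IsLeviCivita g nabla) (x : M) (w : 𝒳) :
    curvature nabla x (u.1 x) (u.1 x) (w.1 x) = 0 := by
  rw [hd.curvature_eq hg hn]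
  simp [curvatureField]

/-- The curvature tensor in the decomposition of the tangent space. -/
lemma curvature_split (hd : IsPetrovData 𝒳 V u form F δ) (hg : IsPetrovMetric g u form δ)
    (hn : IsLeviCivita g nabla) (x : M) (r s t : ℝ) (v w z : V) :
    curvature nabla x (r • u.1 x + v.1.1 x) (s • u.1 x + w.1.1 x) (t • u.1 x + z.1.1 x) =
      (δ * (r * form (F (F w)) z - s * form (F (F v)) z)) • u.1 x +
      ((s * t) • F (F v) - (r * t) • F (F w) + (δ * form (F w) z) • F v
        - (δ * form (F v) z) • F w : V).1.1 x := by
  simp only [map_add, map_smul, LinearMap.add_apply, LinearMap.smul_apply, hd.curvature_u_u hg hn,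
    hd.curvature_V_u_u hg hn, hd.curvature_V_u_V hg hn, hd.curvature_u_V_u hg hn,
    hd.curvature_u_V_V hg hn, hd.curvature_V_V_u hg hn, hd.curvature_V_V_V hg hn,
    Submodule.coe_add, Submodule.coe_sub, Submodule.coe_smul, Pi.add_apply, Pi.sub_apply,
    Pi.smul_apply]
  module

end Curvature

end IsPetrovData

/-! ### Operators with vanishing trace or square -/

section LinearAlgebra

variable {W : Type*} [AddCommGroup W] [Module ℝ W] {F : W →ₗ[ℝ] W}

/-- If every vector in its image is an eigenvector, then a traceless operator has square zero. -/
lemma comp_self_eq_zero_of_trace_eq_zero [FiniteDimensional ℝ W] (ht : LinearMap.trace ℝ W F = 0)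
    (h : ∀ v, ∃ m : ℝ, F (F v) = m • F v) : F ∘ₗ F = 0 := by
  obtain ⟨c, hc⟩ : ∃ c : ℝ, F ∘ₗ F = c • F := by
    let G : LinearMap.range F →ₗ[ℝ] LinearMap.range F :=
      F.restrict fun v _ ↦ LinearMap.mem_range_self F v
    -- An operator on the image of `F` for which every vector is an eigenvector is a scalar.
    obtain ⟨c, hc⟩ := G.exists_eq_smul_id_of_forall_notLinearIndependent (by
      rintro ⟨_, v, rfl⟩ hli
      obtain ⟨m, hm⟩ := h v
      have := LinearIndependent.pair_iff.1 hli (-m) 1 (Subtype.ext (by simp [G, hm]))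
      exact one_ne_zero this.2)
    refine ⟨c, LinearMap.ext fun v ↦ ?_⟩
    have := congr(($hc ⟨F v, LinearMap.mem_range_self F v⟩ : W))
    simpa [G] using this
  by_contra hne
  have hc0 : c ≠ 0 := by
    rintro rfl
    exact hne (by simpa using hc)
  have hid : IsIdempotentElem (c⁻¹ • F) := by
    have hc' : F * F = c • F := hc
    rw [IsIdempotentElem, smul_mul_smul_comm, hc', smul_smul]
    congr 1
    field_simp
  -- The trace of an idempotent is its rank in characteristic zero.
  have h0 : c⁻¹ • F = 0 :=
    LinearMap.IsIdempotentElem.eq_zero_of_trace_eq_zero hid (by rw [map_smul, ht, smul_zero])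
  have hF : F = 0 := by simpa [hc0] using h0
  exact hne (by simp [hF])

/-- The image of a square-zero operator in dimension three is at most one-dimensional. -/
lemma exists_forall_eq_smul_of_comp_self_eq_zero (h3 : Module.finrank ℝ W = 3)
    (h : F ∘ₗ F = 0) : ∃ e : W, ∀ v, ∃ m : ℝ, F v = m • e := by
  have : FiniteDimensional ℝ W := Module.finite_of_finrank_pos (by omega)
  have h1 : Module.finrank ℝ (LinearMap.range F) ≤ Module.finrank ℝ (LinearMap.ker F) :=
    Submodule.finrank_mono (LinearMap.range_le_ker_iff.2 h)
  have h2 := F.finrank_range_add_finrank_ker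
  obtain ⟨e, he⟩ := finrank_le_one_iff.1 (show Module.finrank ℝ (LinearMap.range F) ≤ 1 by omega)
  refine ⟨e, fun v ↦ ?_⟩
  obtain ⟨m, hm⟩ := he ⟨F v, LinearMap.mem_range_self F v⟩
  exact ⟨m, by simpa using congr(($hm : W)).symm⟩

end LinearAlgebra

/-! ### Ricci tensor, the three cases and their geometry -/

namespace IsPetrovData

set_option maxSynthPendingDepth 6

variable {E : Type*} [NormedAddCommGroup E] [NormedSpace ℝ E]
  {M : Type*} [TopologicalSpace M] [ChartedSpace E M] [IsManifold 𝓘(ℝ, E) ∞ M]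
  {𝒳 : Submodule ℝ (Π x : M, TangentSpace 𝓘(ℝ, E) x)} {V : Submodule ℝ 𝒳} {u : 𝒳}
  {form : LinearMap.BilinForm ℝ V} {F : V →ₗ[ℝ] V} {δ : ℝ}
  {g : PseudoRiemannianMetric E M} {nabla : Connection E M}

lemma finrank_eq (hd : IsPetrovData 𝒳 V u form F δ) (x : M) :
    Module.finrank ℝ V + 1 = Module.finrank ℝ E :=
  hd.codim_one.trans (hd.simplyTransitive.evalEquiv x).finrank_eq

variable [FiniteDimensional ℝ E]

/-- The Ricci tensor in the decomposition of the tangent space. -/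
lemma ricci_split (hd : IsPetrovData 𝒳 V u form F δ) (hg : IsPetrovMetric g u form δ)
    (hn : IsLeviCivita g nabla) (x : M) (r t : ℝ) (v z : V) :
    ricci nabla x (r • u.1 x + v.1.1 x) (t • u.1 x + z.1.1 x) =
      - (r * t * LinearMap.trace ℝ V (F ∘ₗ F)) - δ * LinearMap.trace ℝ V F * form (F v) z := by
  have := hd.finite
  change LinearMap.trace ℝ _ ((curvature nabla x (r • u.1 x + v.1.1 x)).flip
    (t • u.1 x + z.1.1 x)) = _
  set A := (curvature nabla x (r • u.1 x + v.1.1 x)).flip (t • u.1 x + z.1.1 x) with hA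
  let B := (hd.tangentEquiv x).symm.conj A
  have hB (s : ℝ) (w : V) : B (s, w) = (δ * (r * form (F (F w)) z - s * form (F (F v)) z),
      (s * t) • F (F v) - (r * t) • F (F w) + (δ * form (F w) z) • F v
        - (δ * form (F v) z) • F w) := by
    rw [LinearEquiv.conj_apply_apply, LinearEquiv.symm_symm, hd.tangentEquiv_apply, hA,
      LinearMap.flip_apply, hd.curvature_split hg hn, hd.tangentEquiv_symm_apply]
  rw [← LinearMap.trace_conj' A (hd.tangentEquiv x).symm, trace_prod_eq]
  -- The rank-one summand has trace `δ⟨F²v, z⟩`, which cancels the `u`-diagonal entry computed in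
  -- `h2`.
  have h1 : LinearMap.snd ℝ ℝ V ∘ₗ B ∘ₗ LinearMap.inr ℝ ℝ V =
      -((r * t) • (F ∘ₗ F)) + ((δ • form.flip z) ∘ₗ F).smulRight (F v)
        - (δ * form (F v) z) • F := by
    ext1 w
    simp [hB]
  have h2 : (B (1, 0)).1 = - (δ * form (F (F v)) z) := by
    rw [hB]
    simp
  change (B (1, 0)).1 + LinearMap.trace ℝ V (LinearMap.snd ℝ ℝ V ∘ₗ B ∘ₗ LinearMap.inr ℝ ℝ V) = _
  rw [h1, h2, map_sub, map_add, map_neg, map_smul, map_smul, LinearMap.trace_smulRight]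
  simp
  ring

/-- With `Ric = c g`, the `u`-direction gives `-tr F² = cδ` and `V` gives `-δ (tr F)⟨Fv, w⟩ = c⟨v,
w⟩`. Eliminating `c` and using nondegeneracy yields the identity. -/
lemma trace_smul_eq (hd : IsPetrovData 𝒳 V u form F δ) (hg : IsPetrovMetric g u form δ)
    (hn : IsLeviCivita g nabla) (hE : g.IsEinstein nabla) (x : M) :
    LinearMap.trace ℝ V F • F = LinearMap.trace ℝ V (F ∘ₗ F) • LinearMap.id := by
  have key (r t : ℝ) (v z : V) := hE.2 x (r • u.1 x + v.1.1 x) (t • u.1 x + z.1.1 x)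
  simp only [hd.ricci_split hg hn, hg.inner_eq] at key
  set c := g.scalarCurvature nabla x / (Module.finrank ℝ E : ℝ)
  have hu := key 1 1 0 0
  simp only [map_zero] at hu
  have hδ := hd.delta_sq
  refine LinearMap.ext fun v ↦ sub_eq_zero.1 (hd.nondegenerate _ fun w ↦ ?_)
  have hv := key 0 0 v w
  simp only [LinearMap.smul_apply, LinearMap.id_apply, map_sub, map_smul, LinearMap.sub_apply,
    smul_eq_mul] at hv ⊢
  linear_combination (-δ) * hv + form v w * hu -
    (LinearMap.trace ℝ V F * form (F v) w) * hδ

lemma trichotomy (hd : IsPetrovData 𝒳 V u form F δ) (hg : IsPetrovMetric g u form δ)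
    (hn : IsLeviCivita g nabla) (hE : g.IsEinstein nabla) (x : M) :
    (∃ r : ℝ, F = r • LinearMap.id) ∨
      (F ≠ 0 ∧ LinearMap.trace ℝ V F = 0 ∧ F ∘ₗ F = 0) ∨
      (F ∘ₗ F ≠ 0 ∧ LinearMap.trace ℝ V F = 0 ∧ LinearMap.trace ℝ V (F ∘ₗ F) = 0) := by
  have key := hd.trace_smul_eq hg hn hE x
  by_cases ht : LinearMap.trace ℝ V F = 0
  · have hpos : 0 < Module.finrank ℝ V := by
      have := hd.finrank_eq x
      have := hE.1
      omega
    have : Nontrivial V := Module.nontrivial_of_finrank_pos hpos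
    -- The identity now reads `0 = (tr F²) Id` on a nonzero space.
    have ht2 : LinearMap.trace ℝ V (F ∘ₗ F) = 0 := by
      obtain ⟨v, hv⟩ := exists_ne (0 : V)
      have h := LinearMap.congr_fun key v
      rw [ht, zero_smul, LinearMap.zero_apply, LinearMap.smul_apply, LinearMap.id_apply] at h
      exact (smul_eq_zero.1 h.symm).resolve_right hv
    by_cases hF : F = 0
    · exact .inl ⟨0, by simp [hF]⟩
    · by_cases hF2 : F ∘ₗ F = 0
      · exact .inr (.inl ⟨hF, ht, hF2⟩)
      · exact .inr (.inr ⟨hF2, ht, ht2⟩)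
  · refine .inl ⟨(LinearMap.trace ℝ V F)⁻¹ * LinearMap.trace ℝ V (F ∘ₗ F), ?_⟩
    rw [mul_smul, ← key, smul_smul, inv_mul_cancel₀ ht, one_smul]

lemma hasConstantSectionalCurvature (hd : IsPetrovData 𝒳 V u form F δ)
    (hg : IsPetrovMetric g u form δ) (hn : IsLeviCivita g nabla) (r : ℝ)
    (hF : F = r • LinearMap.id) : g.HasConstantSectionalCurvature nabla (-δ * r ^ 2) := by
  intro x a b hab
  obtain ⟨s, v, rfl⟩ := hd.exists_tangent_eq a
  obtain ⟨t, w, rfl⟩ := hd.exists_tangent_eq b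
  rw [div_eq_iff hab, hd.curvature_split hg hn]
  simp only [hg.inner_eq, hF]
  simp [hd.symm w v]
  linear_combination (r ^ 2 * (s ^ 2 * form w w - s * t * form v w)) * hd.delta_sq

lemma isFlat (hd : IsPetrovData 𝒳 V u form F δ) (hg : IsPetrovMetric g u form δ)
    (hn : IsLeviCivita g nabla) (hF : F ∘ₗ F = 0) (h4 : Module.finrank ℝ E = 4) :
    IsFlat nabla := by
  intro x
  -- Here `dim V = 3`. With `Fv` and `Fw` both multiples of `e`, the skew term left in the curvature
  -- vanishes.
  obtain ⟨e, he⟩ := exists_forall_eq_smul_of_comp_self_eq_zero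
    (by have := hd.finrank_eq x; omega) hF
  have hFF (v : V) : F (F v) = 0 := LinearMap.congr_fun hF v
  ext a b c
  obtain ⟨r, v, rfl⟩ := hd.exists_tangent_eq a
  obtain ⟨s, w, rfl⟩ := hd.exists_tangent_eq b
  obtain ⟨t, z, rfl⟩ := hd.exists_tangent_eq c
  rw [hd.curvature_split hg hn, hFF, hFF]
  obtain ⟨m, hm⟩ := he v
  obtain ⟨k, hk⟩ := he w
  rw [hm, hk]
  simp
  module

lemma isRicciFlat (hd : IsPetrovData 𝒳 V u form F δ) (hg : IsPetrovMetric g u form δ)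
    (hn : IsLeviCivita g nabla) (h1 : LinearMap.trace ℝ V F = 0)
    (h2 : LinearMap.trace ℝ V (F ∘ₗ F) = 0) : IsRicciFlat nabla := by
  intro x
  refine LinearMap.ext₂ fun a b ↦ ?_
  obtain ⟨r, v, rfl⟩ := hd.exists_tangent_eq a
  obtain ⟨s, w, rfl⟩ := hd.exists_tangent_eq b
  rw [hd.ricci_split hg hn, h1, h2]
  simp

/-- This single component suffices to detect whether `Fv` and `F²v` are proportional. -/
lemma curvatureDerivative_eq (hd : IsPetrovData 𝒳 V u form F δ) (hg : IsPetrovMetric g u form δ)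
    (hn : IsLeviCivita g nabla) (x : M) (v z : V) :
    curvatureDerivative nabla v.1.1 u.1 v.1.1 z.1.1 x =
      (2 * δ) • (form (F v) z • F (F v) - form (F (F v)) z • F v : V).1.1 x := by
  simp only [curvatureDerivative, hd.curvature_u_V_V hg hn, hd.nabla_smul, hd.nabla_V_u hg hn,
    hd.nabla_V_V hg hn, map_neg, map_smul, LinearMap.neg_apply, LinearMap.smul_apply, smul_apply,
    hd.curvature_V_V_V hg hn, hd.curvature_u_u hg hn, hd.curvature_u_V_u hg hn,
    Submodule.coe_sub, Submodule.coe_smul, Pi.sub_apply, Pi.smul_apply]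
  module

lemma not_isLocallySymmetric (hd : IsPetrovData 𝒳 V u form F δ) (hg : IsPetrovMetric g u form δ)
    (hn : IsLeviCivita g nabla) (x : M) (hF : F ∘ₗ F ≠ 0) (h1 : LinearMap.trace ℝ V F = 0) :
    ¬ IsLocallySymmetric nabla := by
  intro hs
  have := hd.finite
  refine hF (comp_self_eq_zero_of_trace_eq_zero h1 fun v ↦ ?_)
  by_cases hv : F v = 0
  · exact ⟨0, by simp [hv]⟩
  -- Such a `z` allows the vanishing component to be solved for `F²v` as a multiple of `Fv`.
  obtain ⟨z, hz⟩ : ∃ z, form (F v) z ≠ 0 := by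
    by_contra! h
    exact hv (hd.nondegenerate _ h)
  have hsm (w : 𝒳) := hd.simplyTransitive.smooth w.1 w.2
  have h0 := congr_fun (hs v.1.1 u.1 v.1.1 z.1.1 (hsm _) (hsm _) (hsm _) (hsm _)) x
  rw [hd.curvatureDerivative_eq hg hn, Pi.zero_apply] at h0
  have hδ : (2 * δ) ≠ 0 := by
    rcases hd.sign with h | h <;> simp [h]
  have h2 := (smul_eq_zero.1 h0).resolve_left hδ
  have h3 : (form (F v) z • F (F v) - form (F (F v)) z • F v : V) = 0 := by
    refine Subtype.ext ((hd.simplyTransitive.evalEquiv x).injective ?_)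
    rw [IsSimplyTransitive.evalEquiv_apply, h2]
    exact (map_zero _).symm
  refine ⟨(form (F v) z)⁻¹ * form (F (F v)) z, ?_⟩
  rw [mul_smul, ← sub_eq_zero.1 h3, smul_smul, inv_mul_cancel₀ hz, one_smul]

end IsPetrovData
end Petrov

theorem lemma3p1
    {E : Type*} [NormedAddCommGroup E] [NormedSpace ℝ E] [FiniteDimensional ℝ E]
    {M : Type*} [TopologicalSpace M] [ChartedSpace E M] [IsManifold 𝓘(ℝ, E) ∞ M] [Nonempty M]
    (𝒳 : Submodule ℝ (Π x : M, TangentSpace 𝓘(ℝ, E) x)) (V : Submodule ℝ 𝒳) (u : 𝒳)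
    (form : LinearMap.BilinForm ℝ V) (F : V →ₗ[ℝ] V) (δ : ℝ)
    (hdata : Petrov.IsPetrovData 𝒳 V u form F δ)
    (g : Petrov.PseudoRiemannianMetric E M) (hg : Petrov.IsPetrovMetric g u form δ)
    (nabla : Petrov.Connection E M) (hnabla : Petrov.IsLeviCivita g nabla)
    (hE : g.IsEinstein nabla) :
    ((∃ r : ℝ, F = r • LinearMap.id) ∨
      (F ≠ 0 ∧ LinearMap.trace ℝ V F = 0 ∧ F ∘ₗ F = 0) ∨
      (F ∘ₗ F ≠ 0 ∧ LinearMap.trace ℝ V F = 0 ∧ LinearMap.trace ℝ V (F ∘ₗ F) = 0)) ∧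
    (∀ r : ℝ, F = r • LinearMap.id → g.HasConstantSectionalCurvature nabla (-δ * r ^ 2)) ∧
    (F ≠ 0 ∧ LinearMap.trace ℝ V F = 0 ∧ F ∘ₗ F = 0 → Module.finrank ℝ E = 4 →
      Petrov.IsFlat nabla) ∧
    (F ∘ₗ F ≠ 0 ∧ LinearMap.trace ℝ V F = 0 ∧ LinearMap.trace ℝ V (F ∘ₗ F) = 0 →
      Petrov.IsRicciFlat nabla ∧ ¬ Petrov.IsLocallySymmetric nabla) := by
  obtain ⟨x⟩ := ‹Nonempty M›
  exact ⟨hdata.trichotomy hg hnabla hE x, hdata.hasConstantSectionalCurvature hg hnabla,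
    fun h h4 ↦ hdata.isFlat hg hnabla h.2.2 h4,
    fun h ↦ ⟨hdata.isRicciFlat hg hnabla h.2.1 h.2.2,
      hdata.not_isLocallySymmetric hg hnabla x h.1 h.2.1⟩⟩
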